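/- Let $\Bbbk$ be a field of characteristic zero and let $W_+$ be the positive Witt algebra over $\Bbbk$, i.e. the Lie algebra with $\Bbbk$-basis $\{e_n : n\in\mathbb{Z}_{\ge 1}\}$ and bracket $[e_i,e_j]=(j-i)e_{i+j}$. Let $\mathrm{U}(W_+)$ be its universal enveloping algebra, equipped with the order filtration: $o(f)\le n$ means that $f$ is a linear combination of products of at most $n$ elements of $W_+$. For a $\Bbbk$-algebra $R$ let $$\operatorname{GKdim} R=\sup_V\ \varlimsup_{n\to\infty}\ \log_n \dim_{\Bbbk}\Big(\sum_{i=0}^n V^i\Big),$$ where $V$ runs over the finite-dimensional subspaces of $R$ (and $\log_n 0$ is read as $0$, so that the zero algebra has GK-dimension $0$). If $f$ is a nonzero element of $\mathrm{U}(W_+)$ with $o(f)\le 2$, and $(f)$ denotes the two-sided ideal generated by $f$, then $$\operatorname{GKdim}\,\mathrm{U}(W_+)/(f)<\infty .$$ -/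

import Mathlib

noncomputable section

/-- The positive Witt algebra `W₊` over `k`: the `k`-vector space with basis `e n`, `n ≥ 1`. -/
def PositiveWitt (k : Type*) [CommRing k] : Type _ := ℕ+ →₀ k

namespace PositiveWitt

variable (k : Type*) [CommRing k]

instance : AddCommGroup (PositiveWitt k) := inferInstanceAs (AddCommGroup (ℕ+ →₀ k))

instance : Module k (PositiveWitt k) := inferInstanceAs (Module k (ℕ+ →₀ k))

/-- The standard basis `e 1, e 2, …` of `W₊`. -/
def e : Module.Basis ℕ+ k (PositiveWitt k) := ⟨LinearEquiv.refl k (ℕ+ →₀ k)⟩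

/-- The bilinear map with `(e i, e j) ↦ (j - i) e (i + j)`. -/
def bracket : PositiveWitt k →ₗ[k] PositiveWitt k →ₗ[k] PositiveWitt k :=
  (e k).constr k fun i => (e k).constr k fun j => (((j : ℕ) : k) - ((i : ℕ) : k)) • e k (i + j)

theorem bracket_e (i j : ℕ+) :
    bracket k (e k i) (e k j) = (((j : ℕ) : k) - ((i : ℕ) : k)) • e k (i + j) := by
  simp [bracket, Module.Basis.constr_basis]

theorem bracket_skew (x y : PositiveWitt k) : bracket k x y = -bracket k y x := by
  have h : bracket k = -(bracket k).flip := by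
    refine (e k).ext fun i => (e k).ext fun j => ?_
    simp only [LinearMap.neg_apply, LinearMap.flip_apply, bracket_e, add_comm j i, ← neg_smul,
      neg_sub]
  exact congrArg (fun B => B x y) h

theorem induction_e {p : PositiveWitt k → Prop} (x : PositiveWitt k) (zero : p 0)
    (add : ∀ a b, p a → p b → p (a + b)) (smul : ∀ (c : k) (i : ℕ+), p (c • e k i)) : p x := by
  have hx : x ∈ Submodule.span k (Set.range (e k)) := by simp [(e k).span_eq]
  rw [← Finsupp.range_linearCombination] at hx
  obtain ⟨g, rfl⟩ := hx
  rw [Finsupp.linearCombination_apply]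
  exact Finset.sum_induction _ p add zero fun i _ => smul _ i

theorem bracket_self (x : PositiveWitt k) : bracket k x x = 0 := by
  induction x using induction_e with
  | zero => simp
  | add a b ha hb => simp [ha, hb, bracket_skew k a b]
  | smul c i => simp [bracket_e]

theorem bracket_leibniz (x y z : PositiveWitt k) :
    bracket k x (bracket k y z) = bracket k (bracket k x y) z + bracket k y (bracket k x z) := by
  induction x using induction_e with
  | zero => simp
  | add a b ha hb => simp only [map_add, LinearMap.add_apply, ha, hb]; abel
  | smul c i =>
  induction y using induction_e with
  | zero => simp
  | add a b ha hb => simp only [map_add, LinearMap.add_apply, ha, hb]; abel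
  | smul d j =>
  induction z using induction_e with
  | zero => simp
  | add a b ha hb => simp only [map_add, ha, hb]; abel
  | smul f l =>
  simp only [map_smul, LinearMap.smul_apply, bracket_e, smul_smul, ← add_assoc, add_comm j i,
    ← add_smul]
  congr 1
  push_cast
  ring

instance : LieRing (PositiveWitt k) where
  bracket x y := bracket k x y
  add_lie x y z := by simp
  lie_add x y z := by simp
  lie_self x := bracket_self k x
  leibniz_lie x y z := bracket_leibniz k x y z

instance : LieAlgebra k (PositiveWitt k) where
  lie_smul c x y := (bracket k x).map_smul c y

theorem lie_e (i j : ℕ+) :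
    ⁅e k i, e k j⁆ = (((j : ℕ) : k) - ((i : ℕ) : k)) • e k (i + j) := bracket_e k i j

end PositiveWitt

section

attribute [local instance] LieRing.ofAssociativeRing

/-- The `n`-th piece of the order filtration of the enveloping algebra `U(L)`: the span of all
products of at most `n` elements of `L`. An element has order at most `n` iff it lies in it. -/
def UniversalEnvelopingAlgebra.orderFiltration (k L : Type*) [CommRing k] [LieRing L]
    [LieAlgebra k L] (n : ℕ) : Submodule k (UniversalEnvelopingAlgebra k L) :=
  ⨆ i ∈ Finset.range (n + 1),
    (LinearMap.range (UniversalEnvelopingAlgebra.ι k : L →ₗ⁅k⁆ _).toLinearMap) ^ i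

end

/-- The growth function `n ↦ dim (V⁰ + V¹ + ⋯ + Vⁿ)` of a subspace `V` of an algebra. -/
def growthFun (k : Type*) {A : Type*} [Field k] [Ring A] [Algebra k A] (V : Submodule k A)
    (n : ℕ) : ℕ :=
  Module.finrank k ↥(⨆ i ∈ Finset.range (n + 1), V ^ i)

/-- The Gelfand–Kirillov dimension of a `k`-algebra: the supremum, over all finite-dimensional
subspaces `V` (equivalently, over the finitely generated subalgebras they generate), of
`limsup log_n dim (V⁰ + ⋯ + Vⁿ)`. It is infinite iff it equals `⊤`. -/
def gkDim (k A : Type*) [Field k] [Ring A] [Algebra k A] : EReal :=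
  ⨆ (V : Submodule k A) (_ : FiniteDimensional k V),
    Filter.limsup (fun n : ℕ => ((Real.logb n (growthFun k V n) : ℝ) : EReal)) Filter.atTop

end

/-!
Write `x i` for the image of `e (i + 1)` in the quotient and give it the weight `i + C`. When `C`
exceeds all indices occurring in `f`, the linear part of `f` has lower weight than its quadratic
part, and so do all commutators `⁅x i, x j⁆`. Choose in `f` a quadratic term `x i₀ * x j₀`,
`i₀ ≤ j₀`, for which `i₀ + j₀`, and then `j₀`, is largest: modulo lower weight it is a combination
of products `x i * x j` with `i + j = i₀ + j₀` and `i₀ < i < j₀`. Applying `ad (x m) ∘ ad (x n)` to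
this relation expresses `x p * x q`, for `p = n + j₀ + 1 ≤ q = m + i₀ + 1` with `p` large, through
products `x i * x j` with `i + j = p + q` and `i < p`, again modulo lower weight. Replacing `p, q`
by such `i, j` increases the sum of the squares of the indices without changing the weight, so that
this straightening terminates. It leaves only the monomials with at most one index `≥ N`, where
`N = 2 * j₀ + 2`, and the number of these of weight less than `d` is at most `d ^ (N + 1)`.
-/

section WeightFiltration

section Semiring

variable {k A ι : Type*} [CommSemiring k] [Semiring A] [Algebra k A] {x : ι → A} {w : ι → ℕ}

/-- The strict weight filtration on the subalgebra generated by a family `x`, where `x i` is given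
the weight `w i`: the span of all words in the `x i` of total weight less than `d`. Since the
inequality is strict, the words of weight at most `d` span `weightLT k x w (d + 1)`. -/
def weightLT (k : Type*) {A ι : Type*} [CommSemiring k] [Semiring A] [Algebra k A] (x : ι → A)
    (w : ι → ℕ) (d : ℕ) : Submodule k A :=
  Submodule.span k ((fun l : List ι => (l.map x).prod) '' {l | (l.map w).sum < d})

theorem prod_mem_weightLT {l : List ι} {d : ℕ} (h : (l.map w).sum < d) :
    (l.map x).prod ∈ weightLT k x w d :=
  Submodule.subset_span ⟨l, h, rfl⟩

theorem one_mem_weightLT {d : ℕ} (h : 0 < d) : (1 : A) ∈ weightLT k x w d := by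
  simpa using prod_mem_weightLT (k := k) (x := x) (w := w) (l := []) (by simpa using h)

theorem self_mem_weightLT {i : ι} {d : ℕ} (h : w i < d) : x i ∈ weightLT k x w d := by
  simpa using prod_mem_weightLT (k := k) (x := x) (w := w) (l := [i]) (by simpa using h)

theorem weightLT_mono {d e : ℕ} (h : d ≤ e) : weightLT k x w d ≤ weightLT k x w e :=
  Submodule.span_mono (Set.image_mono fun _ hl => lt_of_lt_of_le hl h)

theorem mul_mem_weightLT {a b : A} {d e n : ℕ} (ha : a ∈ weightLT k x w d)
    (hb : b ∈ weightLT k x w e) (h : d + e ≤ n + 1) : a * b ∈ weightLT k x w n := by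
  have hab := Submodule.mul_mem_mul ha hb
  rw [weightLT, weightLT, Submodule.span_mul_span] at hab
  refine Submodule.span_le.2 ?_ hab
  rintro _ ⟨_, ⟨l, hl, rfl⟩, _, ⟨l', hl', rfl⟩, rfl⟩
  rw [Set.mem_ofPred_eq] at hl hl'
  simp only [← List.prod_append, ← List.map_append]
  exact prod_mem_weightLT (by rw [List.map_append, List.sum_append]; omega)

theorem iSup_pow_le_weightLT {V : Submodule k A} {d : ℕ} (hV : V ≤ weightLT k x w (d + 1))
    (n : ℕ) : ⨆ i ∈ Finset.range (n + 1), V ^ i ≤ weightLT k x w (n * d + 1) := by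
  have hpow (i : ℕ) : V ^ i ≤ weightLT k x w (i * d + 1) := by
    induction i with
    | zero => exact Submodule.one_le.2 (one_mem_weightLT (by omega))
    | succ i ih =>
      rw [pow_succ, Submodule.mul_le]
      exact fun a ha b hb => mul_mem_weightLT (ih ha) (hV hb) (by rw [Nat.succ_mul]; omega)
  refine iSup₂_le fun i hi => (hpow i).trans (weightLT_mono ?_)
  gcongr
  exact Nat.lt_succ_iff.1 (Finset.mem_range.1 hi)

theorem exists_mem_weightLT (w : ι → ℕ) {a : A} (ha : a ∈ Algebra.adjoin k (Set.range x)) :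
    ∃ d, a ∈ weightLT k x w d := by
  induction ha using Algebra.adjoin_induction with
  | mem a ha =>
    obtain ⟨i, rfl⟩ := ha
    exact ⟨w i + 1, self_mem_weightLT (Nat.lt_succ_self _)⟩
  | algebraMap c =>
    rw [Algebra.algebraMap_eq_smul_one]
    exact ⟨1, Submodule.smul_mem _ _ (one_mem_weightLT one_pos)⟩
  | add a b _ _ ha hb =>
    obtain ⟨d, hd⟩ := ha
    obtain ⟨e, he⟩ := hb
    exact ⟨d + e, add_mem (weightLT_mono (by omega) hd) (weightLT_mono (by omega) he)⟩
  | mul a b _ _ ha hb =>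
    obtain ⟨d, hd⟩ := ha
    obtain ⟨e, he⟩ := hb
    exact ⟨d + e, mul_mem_weightLT hd he (by omega)⟩

theorem exists_le_weightLT (w : ι → ℕ) (hgen : Algebra.adjoin k (Set.range x) = ⊤)
    {V : Submodule k A} (hV : V.FG) : ∃ d, V ≤ weightLT k x w (d + 1) := by
  obtain ⟨s, rfl⟩ := hV
  choose d hd using fun a => exists_mem_weightLT (k := k) (x := x) w (a := a) (by simp [hgen])
  refine ⟨s.sup d, Submodule.span_le.2 fun a ha => weightLT_mono ?_ (hd a)⟩
  exact (Finset.le_sup (Finset.mem_coe.1 ha)).trans (Nat.le_succ _)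

end Semiring

section OrderedMonomial

variable {ι : Type*} [LinearOrder ι]

theorem sum_map_sort (w : ι → ℕ) (s : Multiset ι) : (s.sort.map w).sum = (s.map w).sum := by
  rw [← Multiset.sum_coe, ← Multiset.map_coe, Multiset.sort_eq]

section Monoid

variable {A : Type*} [Monoid A] {x : ι → A}

/-- The ordered (Poincaré–Birkhoff–Witt) monomial `x i₁ * ⋯ * x iₙ` with `i₁ ≤ ⋯ ≤ iₙ` attached to
the multiset `{i₁, …, iₙ}`. -/
def orderedMonomial (x : ι → A) (s : Multiset ι) : A := (s.sort.map x).prod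

theorem orderedMonomial_cons {i : ι} {s : Multiset ι} (h : ∀ j ∈ s, i ≤ j) :
    orderedMonomial x (i ::ₘ s) = x i * orderedMonomial x s := by
  rw [orderedMonomial, Multiset.sort_cons _ _ _ h, List.map_cons, List.prod_cons, orderedMonomial]

theorem orderedMonomial_pair {i j : ι} (h : i ≤ j) :
    orderedMonomial x {i, j} = x i * x j := by
  rw [Multiset.insert_eq_cons, orderedMonomial_cons (by simpa using h)]
  simp [orderedMonomial]

end Monoid

section Semiring

variable {k A B : Type*} [CommSemiring k] [Semiring A] [Semiring B] [Algebra k A] [Algebra k B]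
  {x : ι → A} {w : ι → ℕ}

theorem map_linearCombination_orderedMonomial (π : A →ₐ[k] B) (a : Multiset ι →₀ k) :
    π (Finsupp.linearCombination k (orderedMonomial x) a) =
      Finsupp.linearCombination k (orderedMonomial (π ∘ x)) a := by
  have h : π.toLinearMap ∘ orderedMonomial x = orderedMonomial (π ∘ x) :=
    funext fun s => by simp [orderedMonomial, map_list_prod]
  rw [← h, ← LinearMap.map_finsupp_linearCombination, AlgHom.toLinearMap_apply]

theorem orderedMonomial_mem_weightLT {s : Multiset ι} {d : ℕ} (h : (s.map w).sum < d) :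
    orderedMonomial x s ∈ weightLT k x w d :=
  prod_mem_weightLT (by rwa [sum_map_sort])

end Semiring

end OrderedMonomial

section Commutator

attribute [local instance] LieRing.ofAssociativeRing

variable {k A ι : Type*} [CommRing k] [Ring A] [Algebra k A] {x : ι → A} {w : ι → ℕ}

theorem commutator_mul (a b c : A) : ⁅a, b * c⁆ = ⁅a, b⁆ * c + b * ⁅a, c⁆ := by
  simp only [Ring.lie_def]
  noncomm_ring

theorem lie_mem_weightLT {y : A} {e : ℕ} (hy : ∀ i, ⁅y, x i⁆ ∈ weightLT k x w (w i + e + 1))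
    {a : A} {d : ℕ} (ha : a ∈ weightLT k x w d) : ⁅y, a⁆ ∈ weightLT k x w (d + e) := by
  have hword (l : List ι) : ⁅y, (l.map x).prod⁆ ∈ weightLT k x w ((l.map w).sum + e + 1) := by
    induction l with
    | nil => simp [Ring.lie_def]
    | cons i l ih =>
      simp only [List.map_cons, List.prod_cons, List.sum_cons, commutator_mul]
      exact add_mem
        (mul_mem_weightLT (hy i) (prod_mem_weightLT (Nat.lt_succ_self _)) (by omega))
        (mul_mem_weightLT (self_mem_weightLT (Nat.lt_succ_self _)) ih (by omega))
  induction ha using Submodule.span_induction with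
  | mem a ha =>
    obtain ⟨l, hl, rfl⟩ := ha
    rw [Set.mem_ofPred_eq] at hl
    exact weightLT_mono (by omega) (hword l)
  | zero => simp
  | add a b _ _ ha hb => rw [lie_add]; exact add_mem ha hb
  | smul c a _ ha => rw [lie_smul]; exact Submodule.smul_mem _ _ ha

variable (hcomm : ∀ i j, ⁅x i, x j⁆ ∈ weightLT k x w (w i + w j))
include hcomm

theorem prod_sub_prod_mem_weightLT {l l' : List ι} (h : l.Perm l') :
    (l.map x).prod - (l'.map x).prod ∈ weightLT k x w (l.map w).sum := by
  induction h with
  | nil => simp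
  | cons i _ ih =>
    simp only [List.map_cons, List.prod_cons, List.sum_cons, ← mul_sub]
    exact mul_mem_weightLT (self_mem_weightLT (Nat.lt_succ_self _)) ih (by omega)
  | swap i j l =>
    have hswap : ((j :: i :: l).map x).prod - ((i :: j :: l).map x).prod =
        ⁅x j, x i⁆ * (l.map x).prod := by
      simp only [List.map_cons, List.prod_cons, Ring.lie_def, sub_mul, mul_assoc]
    rw [hswap]
    exact mul_mem_weightLT (hcomm j i) (prod_mem_weightLT (Nat.lt_succ_self _))
      (by simp only [List.map_cons, List.sum_cons]; omega)
  | trans h _ ih ih' =>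
    rw [← (h.map w).sum_eq] at ih'
    simpa using add_mem ih ih'

variable [LinearOrder ι]

theorem prod_sub_orderedMonomial_mem_weightLT (l : List ι) :
    (l.map x).prod - orderedMonomial x l ∈ weightLT k x w (l.map w).sum :=
  prod_sub_prod_mem_weightLT hcomm (Multiset.coe_eq_coe.1 (Multiset.sort_eq _ _).symm)

theorem weightLT_eq_span_orderedMonomial (d : ℕ) :
    weightLT k x w d = Submodule.span k (orderedMonomial x '' {s | (s.map w).sum < d}) := by
  refine le_antisymm ?_ (Submodule.span_le.2 ?_)
  · induction d with
    | zero => simp [weightLT]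
    | succ d ih =>
      refine Submodule.span_le.2 ?_
      rintro _ ⟨l, hl, rfl⟩
      have hlt : weightLT k x w (l.map w).sum ≤
          Submodule.span k (orderedMonomial x '' {s | (s.map w).sum < d + 1}) :=
        (weightLT_mono (Nat.lt_succ_iff.1 hl)).trans <| ih.trans <| Submodule.span_mono <|
          Set.image_mono fun _ hs => Nat.lt_succ_of_lt hs
      have hord : orderedMonomial x (l : Multiset ι) ∈
          Submodule.span k (orderedMonomial x '' {s | (s.map w).sum < d + 1}) :=
        Submodule.subset_span (Set.mem_image_of_mem _ (by simpa using hl))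
      exact (Submodule.sub_mem_iff_left _ hord).1
        (hlt (prod_sub_orderedMonomial_mem_weightLT hcomm l))
  · rintro _ ⟨s, hs, rfl⟩
    exact orderedMonomial_mem_weightLT hs

end Commutator

end WeightFiltration

section StandardMonomial

variable {w : ℕ → ℕ} {N d : ℕ}

/-- The exponents of the standard monomials: the multisets of weight less than `d` with at most one
element `≥ N`, counted with multiplicity. -/
def standardMultisets (w : ℕ → ℕ) (N d : ℕ) : Set (Multiset ℕ) :=
  {s | (s.map w).sum < d ∧ (s.filter (N ≤ ·)).card ≤ 1}

theorem sum_map_filter_le {ι : Type*} (w : ι → ℕ) (P : ι → Prop) [DecidablePred P]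
    (s : Multiset ι) : ((s.filter P).map w).sum ≤ (s.map w).sum := by
  conv_rhs => rw [← Multiset.filter_add_not P s, Multiset.map_add, Multiset.sum_add]
  exact Nat.le_add_right _ _

theorem eq_of_card_le_one_of_sum_succ_eq {s t : Multiset ℕ} (hs : s.card ≤ 1) (ht : t.card ≤ 1)
    (h : (s.map (· + 1)).sum = (t.map (· + 1)).sum) : s = t := by
  rw [Nat.le_one_iff_eq_zero_or_eq_one, Multiset.card_eq_zero, Multiset.card_eq_one] at hs ht
  obtain rfl | ⟨a, rfl⟩ := hs <;> obtain rfl | ⟨b, rfl⟩ := ht <;> simp_all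

/-- A code for multisets with at most one element `≥ N`: the multiplicities of the elements `< N`,
and the sum of `i + 1` over the elements `i ≥ N`, which is `0` when there is none. -/
def standardCode (N : ℕ) (s : Multiset ℕ) : (Fin N → ℕ) × ℕ :=
  (fun i => s.count (i : ℕ), ((s.filter (N ≤ ·)).map (· + 1)).sum)

theorem injOn_standardCode :
    Set.InjOn (standardCode N) {s | (s.filter (N ≤ ·)).card ≤ 1} := by
  intro s hs t ht hst
  rw [standardCode, standardCode, Prod.mk.injEq, funext_iff] at hst
  have hfilter := eq_of_card_le_one_of_sum_succ_eq hs ht hst.2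
  refine Multiset.ext.2 fun i => ?_
  by_cases hi : i < N
  · exact hst.1 ⟨i, hi⟩
  · rw [← Multiset.count_filter_of_pos (p := (N ≤ ·)) (not_lt.1 hi), hfilter,
      Multiset.count_filter_of_pos (p := (N ≤ ·)) (not_lt.1 hi)]

theorem mapsTo_standardCode (hw : ∀ i, i < w i) :
    Set.MapsTo (standardCode N) (standardMultisets w N d)
      ↑(Fintype.piFinset (fun _ : Fin N => Finset.range d) ×ˢ Finset.range d) := by
  intro s hs
  have hcard : s.card ≤ (s.map w).sum := by
    simpa using Multiset.sum_map_le_sum_map (fun _ => 1) w (s := s) fun i _ => by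
      have := hw i; omega
  have hsum : ((s.filter (N ≤ ·)).map (· + 1)).sum ≤ (s.map w).sum :=
    (Multiset.sum_map_le_sum_map (· + 1) w fun i _ => hw i).trans (sum_map_filter_le w _ s)
  simp only [Finset.mem_coe, Finset.mem_product, Fintype.mem_piFinset, Finset.mem_range]
  exact ⟨fun i => ((s.count_le_card _).trans hcard).trans_lt hs.1, hsum.trans_lt hs.1⟩

theorem finite_standardMultisets (hw : ∀ i, i < w i) : (standardMultisets w N d).Finite :=
  Set.Finite.of_injOn (mapsTo_standardCode hw) (injOn_standardCode.mono fun _ hs => hs.2)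
    (Finset.finite_toSet _)

theorem ncard_standardMultisets_le (hw : ∀ i, i < w i) :
    (standardMultisets w N d).ncard ≤ d ^ (N + 1) := by
  refine (Set.ncard_le_ncard_of_injOn _ (mapsTo_standardCode hw)
    (injOn_standardCode.mono fun _ hs => hs.2)).trans ?_
  rw [Set.ncard_coe_finset]
  simp [pow_succ]

theorem exists_eq_cons_cons_of_one_lt_card_filter {ι : Type*} {P : ι → Prop} [DecidablePred P]
    {s : Multiset ι} (h : 1 < (s.filter P).card) : ∃ a b t, P a ∧ P b ∧ s = a ::ₘ b ::ₘ t := by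
  obtain ⟨a, ha⟩ := Multiset.card_pos_iff_exists_mem.1 (Nat.zero_lt_one.trans h)
  obtain ⟨u, hu⟩ := Multiset.exists_cons_of_mem ha
  rw [hu, Multiset.card_cons] at h
  obtain ⟨b, hb⟩ := Multiset.card_pos_iff_exists_mem.1 (Nat.pos_of_lt_add_left h)
  obtain ⟨v, rfl⟩ := Multiset.exists_cons_of_mem hb
  refine ⟨a, b, v + s.filter (¬P ·), Multiset.of_mem_filter ha, Multiset.of_mem_filter (s := s) ?_,
    ?_⟩
  · rw [hu]
    exact Multiset.mem_cons_of_mem hb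
  · rw [← Multiset.cons_add, ← Multiset.cons_add, ← hu, Multiset.filter_add_not]

end StandardMonomial

section GrowthBound

open Asymptotics Filter

variable {k A : Type*} [Field k] [Ring A] [Algebra k A]

theorem limsup_logb_le_of_isBigO_pow {g : ℕ → ℕ} {r : ℕ}
    (h : (fun n => (g n : ℝ)) =O[atTop] fun n : ℕ => (n : ℝ) ^ r) :
    limsup (fun n : ℕ => ((Real.logb n (g n) : ℝ) : EReal)) atTop ≤ r := by
  obtain ⟨c, hc, hbound⟩ := h.exists_pos
  have hlim : Tendsto (fun n : ℕ => Real.logb n (max c 1) + r) atTop (nhds (0 + r)) :=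
    ((Real.tendsto_log_atTop.comp tendsto_natCast_atTop_atTop).const_div_atTop _).add_const _
  rw [zero_add] at hlim
  refine le_of_le_of_eq (limsup_le_limsup ?_)
    ((continuous_coe_real_ereal.tendsto _).comp hlim).limsup_eq
  filter_upwards [hbound.bound, eventually_gt_atTop 1] with n hn hn1
  have hn1 : (1 : ℝ) < n := by exact_mod_cast hn1
  have hlogb : 0 ≤ Real.logb n (max c 1) := Real.logb_nonneg hn1 (le_max_right _ _)
  rw [Function.comp_apply, EReal.coe_le_coe_iff]
  rcases (g n).eq_zero_or_pos with hg | hg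
  · rw [hg, Nat.cast_zero, Real.logb_zero]
    positivity
  · have hle : (g n : ℝ) ≤ max c 1 * (n : ℝ) ^ r := by
      rw [Real.norm_natCast, Real.norm_of_nonneg (by positivity)] at hn
      exact hn.trans (by gcongr; exact le_max_left _ _)
    calc Real.logb n (g n) ≤ Real.logb n (max c 1 * (n : ℝ) ^ r) :=
          Real.logb_le_logb_of_le hn1 (by exact_mod_cast hg) hle
      _ = Real.logb n (max c 1) + r := by
          rw [Real.logb_mul (by positivity) (by positivity), Real.logb_pow,
            Real.logb_self_eq_one hn1, mul_one]

theorem gkDim_le_of_growthFun_isBigO {r : ℕ}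
    (h : ∀ V : Submodule k A, FiniteDimensional k V →
      (fun n => (growthFun k V n : ℝ)) =O[atTop] fun n : ℕ => (n : ℝ) ^ r) :
    gkDim k A ≤ r :=
  iSup₂_le fun V hV => limsup_logb_le_of_isBigO_pow (h V hV)

theorem isBigO_mul_add_one_pow (d r : ℕ) :
    (fun n : ℕ => (((n * d + 1) ^ r : ℕ) : ℝ)) =O[atTop] fun n : ℕ => (n : ℝ) ^ r := by
  refine IsBigO.of_bound ((d + 1 : ℝ) ^ r) ?_
  filter_upwards [eventually_ge_atTop 1] with n hn
  rw [Real.norm_natCast, Real.norm_of_nonneg (by positivity), ← mul_pow]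
  exact_mod_cast Nat.pow_le_pow_left (by nlinarith) r

theorem gkDim_le_of_weightLT_le_span_standard {x : ℕ → A} {w : ℕ → ℕ} {N : ℕ}
    (hgen : Algebra.adjoin k (Set.range x) = ⊤) (hw : ∀ i, i < w i)
    (hstd : ∀ d, weightLT k x w d ≤
      Submodule.span k (orderedMonomial x '' standardMultisets w N d)) :
    gkDim k A ≤ (N + 1 : ℕ) := by
  refine gkDim_le_of_growthFun_isBigO fun V hV => ?_
  obtain ⟨d, hd⟩ := exists_le_weightLT w hgen ((Submodule.fg_iff_finiteDimensional V).2 hV)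
  refine IsBigO.trans (.of_norm_le fun n => ?_) (isBigO_mul_add_one_pow d (N + 1))
  have hfin := finite_standardMultisets (N := N) (d := n * d + 1) hw
  have := FiniteDimensional.span_of_finite k (hfin.image (orderedMonomial x))
  rw [Real.norm_natCast, Nat.cast_le]
  calc growthFun k V n
    _ ≤ Module.finrank k (Submodule.span k (orderedMonomial x '' standardMultisets w N _)) :=
        Submodule.finrank_mono ((iSup_pow_le_weightLT hd n).trans (hstd _))
    _ ≤ (orderedMonomial x '' standardMultisets w N (n * d + 1)).ncard := by
        rw [Module.finrank_eq_spanFinrank_of_free, Submodule.spanFinrank_top]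
        exact Submodule.spanFinrank_span_le_ncard_of_finite (hfin.image _)
    _ ≤ (standardMultisets w N (n * d + 1)).ncard := Set.ncard_image_le hfin
    _ ≤ (n * d + 1) ^ (N + 1) := ncard_standardMultisets_le hw

end GrowthBound

theorem mem_span_of_straightening {k M ι α : Type*} [Semiring k] [AddCommMonoid M] [Module k M]
    [Preorder α] [WellFoundedLT α] {v : ι → M} {φ : ι → α} {S : Set ι}
    (h : ∀ i ∉ S, v i ∈ Submodule.span k (v '' {j | φ j < φ i})) (i : ι) :
    v i ∈ Submodule.span k (v '' {j | j ∈ S ∧ φ j ≤ φ i}) := by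
  induction hi : φ i using WellFoundedLT.induction generalizing i with
  | ind a ih =>
    subst hi
    by_cases hS : i ∈ S
    · exact Submodule.subset_span ⟨i, And.intro hS le_rfl, rfl⟩
    · refine Submodule.span_le.2 ?_ (h i hS)
      rintro _ ⟨j, hj, rfl⟩
      refine Submodule.span_mono (Set.image_mono fun l hl => ?_) (ih _ hj j rfl)
      exact ⟨hl.1, hl.2.trans hj.le⟩

theorem mem_of_linearCombination_eq_zero {k M ι : Type*} [DivisionRing k] [AddCommGroup M]
    [Module k M] {v : ι → M} {a : ι →₀ k} (h : Finsupp.linearCombination k v a = 0) {i : ι}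
    (hi : i ∈ a.support) {P : Submodule k M} (hP : ∀ j ∈ a.support, j ≠ i → v j ∈ P) :
    v i ∈ P := by
  classical
  rw [Finsupp.linearCombination_apply, Finsupp.sum, ← Finset.add_sum_erase _ _ hi] at h
  rw [← Submodule.smul_mem_iff P (Finsupp.mem_support_iff.1 hi), eq_neg_of_add_eq_zero_left h]
  exact neg_mem <| sum_mem fun j hj =>
    P.smul_mem _ (hP j (Finset.mem_of_mem_erase hj) (Finset.ne_of_mem_erase hj))

section Quadratic

attribute [local instance] LieRing.ofAssociativeRing

variable {k A : Type*} [CommRing k] [Ring A] [Algebra k A] {x : ℕ → A} {C : ℕ}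

/-- The span of the products `x i * x j` with `i ∈ S` and `i + j = n`, together with all words of
lower weight. The weight of `x i` is `i + C`, so that all these products have the same weight
`n + 2 * C`; for large `C` the words of lower weight include any given linear part. -/
def quadraticSpan (k : Type*) {A : Type*} [CommRing k] [Ring A] [Algebra k A] (x : ℕ → A)
    (C : ℕ) (S : Set ℕ) (n : ℕ) : Submodule k A :=
  Submodule.span k {a | ∃ i ∈ S, ∃ j, i + j = n ∧ a = x i * x j} ⊔
    weightLT k x (· + C) (n + 2 * C)

theorem mul_mem_quadraticSpan {S : Set ℕ} {i j n : ℕ} (hi : i ∈ S) (hij : i + j = n) :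
    x i * x j ∈ quadraticSpan k x C S n :=
  Submodule.mem_sup_left (Submodule.subset_span ⟨i, hi, j, hij, rfl⟩)

theorem weightLT_le_quadraticSpan {S : Set ℕ} {n : ℕ} :
    weightLT k x (· + C) (n + 2 * C) ≤ quadraticSpan k x C S n :=
  le_sup_right

/-- The termination measure of the straightening process: the weight, and then the amount by which
the sum of squares falls short of the square of the weight. -/
def straighteningRank (C : ℕ) (s : Multiset ℕ) : ℕ ×ₗ ℕ :=
  toLex ((s.map (· + C)).sum, (s.map (· + C)).sum ^ 2 - (s.map (· ^ 2)).sum)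

theorem sum_map_sq_le_sq_sum_map_add (C : ℕ) (s : Multiset ℕ) :
    (s.map (· ^ 2)).sum ≤ (s.map (· + C)).sum ^ 2 := by
  induction s using Multiset.induction with
  | empty => simp
  | cons i s ih =>
    simp only [Multiset.map_cons, Multiset.sum_cons]
    calc i ^ 2 + (s.map (· ^ 2)).sum ≤ (i + C) ^ 2 + (s.map (· + C)).sum ^ 2 := by gcongr; omega
      _ ≤ (i + C + (s.map (· + C)).sum) ^ 2 := pow_add_pow_le zero_le zero_le two_ne_zero

theorem straighteningRank_lt_of_sum_lt {s t : Multiset ℕ}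
    (h : (s.map (· + C)).sum < (t.map (· + C)).sum) :
    straighteningRank C s < straighteningRank C t :=
  Prod.Lex.toLex_lt_toLex.2 (.inl h)

theorem straighteningRank_cons_cons_lt {i j p q : ℕ} (s : Multiset ℕ) (hip : i < p) (hpq : p ≤ q)
    (hij : i + j = p + q) :
    straighteningRank C (i ::ₘ j ::ₘ s) < straighteningRank C (p ::ₘ q ::ₘ s) := by
  have hsq : p ^ 2 + q ^ 2 < i ^ 2 + j ^ 2 := by
    obtain ⟨r, rfl⟩ := Nat.exists_eq_add_of_lt hip
    obtain rfl : j = r + 1 + q := by omega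
    nlinarith
  have hwt : ((i ::ₘ j ::ₘ s).map (· + C)).sum = ((p ::ₘ q ::ₘ s).map (· + C)).sum := by
    simp only [Multiset.map_cons, Multiset.sum_cons]
    omega
  have hle := sum_map_sq_le_sq_sum_map_add C (i ::ₘ j ::ₘ s)
  rw [hwt] at hle
  refine Prod.Lex.toLex_lt_toLex.2 (.inr ⟨hwt, ?_⟩)
  rw [hwt]
  simp only [Multiset.map_cons (· ^ 2), Multiset.sum_cons] at hle ⊢
  omega

section

variable (hcomm : ∀ i j, ⁅x i, x j⁆ ∈ weightLT k x (· + C) (i + C + (j + C)))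
include hcomm

theorem mul_mul_orderedMonomial_sub_mem_weightLT (i j : ℕ) (s : Multiset ℕ) :
    x i * x j * orderedMonomial x s - orderedMonomial x (i ::ₘ j ::ₘ s) ∈
      weightLT k x (· + C) ((i ::ₘ j ::ₘ s).map (· + C)).sum := by
  have h := prod_sub_orderedMonomial_mem_weightLT (w := (· + C)) hcomm (i :: j :: s.sort)
  rw [← Multiset.cons_coe, ← Multiset.cons_coe, Multiset.sort_eq] at h
  simpa only [List.map_cons, List.prod_cons, List.sum_cons, Multiset.map_cons, Multiset.sum_cons,
    sum_map_sort, mul_assoc, ← orderedMonomial.eq_def] using h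

theorem weightLT_le_span_straighteningRank_lt (s : Multiset ℕ) :
    weightLT k x (· + C) (s.map (· + C)).sum ≤
      Submodule.span k (orderedMonomial x '' {t | straighteningRank C t < straighteningRank C s}) :=
  (weightLT_eq_span_orderedMonomial (w := (· + C)) hcomm _).le.trans
    (Submodule.span_mono (Set.image_mono fun _ ht => straighteningRank_lt_of_sum_lt ht))

theorem orderedMonomial_cons_cons_mem_span {p q : ℕ} (hpq : p ≤ q)
    (hrel : x p * x q ∈ quadraticSpan k x C (Set.Iio p) (p + q)) (s : Multiset ℕ) :
    orderedMonomial x (p ::ₘ q ::ₘ s) ∈ Submodule.span k (orderedMonomial x ''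
      {t | straighteningRank C t < straighteningRank C (p ::ₘ q ::ₘ s)}) := by
  set P := Submodule.span k (orderedMonomial x ''
    {t | straighteningRank C t < straighteningRank C (p ::ₘ q ::ₘ s)})
  have hlower : weightLT k x (· + C) ((p ::ₘ q ::ₘ s).map (· + C)).sum ≤ P :=
    weightLT_le_span_straighteningRank_lt hcomm _
  have hswap (i j : ℕ) (hij : i + j = p + q) :
      x i * x j * orderedMonomial x s - orderedMonomial x (i ::ₘ j ::ₘ s) ∈ P := by
    have h := mul_mul_orderedMonomial_sub_mem_weightLT hcomm i j s
    refine hlower (weightLT_mono (le_of_eq ?_) h)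
    simp only [Multiset.map_cons, Multiset.sum_cons]
    omega
  suffices hmap : quadraticSpan k x C (Set.Iio p) (p + q) ≤
      P.comap (LinearMap.mulRight k (orderedMonomial x s)) by
    have hpq' : x p * x q * orderedMonomial x s ∈ P := hmap hrel
    exact (P.sub_mem_iff_right hpq').1 (hswap p q rfl)
  refine sup_le (Submodule.span_le.2 ?_) fun a ha => ?_
  · rintro _ ⟨i, hi, j, hij, rfl⟩
    have hP : orderedMonomial x (i ::ₘ j ::ₘ s) ∈ P := Submodule.subset_span
      (Set.mem_image_of_mem _ (straighteningRank_cons_cons_lt s hi hpq hij))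
    exact (P.sub_mem_iff_left hP).1 (hswap i j hij)
  · refine hlower (mul_mem_weightLT ha (orderedMonomial_mem_weightLT (Nat.lt_succ_self _)) ?_)
    simp only [Multiset.map_cons, Multiset.sum_cons]
    omega

theorem weightLT_le_span_standard {N : ℕ} (hrel : ∀ p q, N ≤ p → p ≤ q →
      x p * x q ∈ quadraticSpan k x C (Set.Iio p) (p + q)) (d : ℕ) :
    weightLT k x (· + C) d ≤
      Submodule.span k (orderedMonomial x '' standardMultisets (· + C) N d) := by
  have hstraighten (s : Multiset ℕ) (hs : s ∉ {s | (s.filter (N ≤ ·)).card ≤ 1}) :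
      orderedMonomial x s ∈ Submodule.span k (orderedMonomial x ''
        {t | straighteningRank C t < straighteningRank C s}) := by
    obtain ⟨p, q, t, hp, hq, rfl⟩ := exists_eq_cons_cons_of_one_lt_card_filter (not_le.1 hs)
    rcases le_total p q with hpq | hqp
    · exact orderedMonomial_cons_cons_mem_span hcomm hpq (hrel p q hp hpq) t
    · rw [Multiset.cons_swap]
      exact orderedMonomial_cons_cons_mem_span hcomm hqp (hrel q p hq hqp) t
  rw [weightLT_eq_span_orderedMonomial (w := (· + C)) hcomm, Submodule.span_le]
  rintro _ ⟨s, hs, rfl⟩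
  refine Submodule.span_mono (Set.image_mono fun t ht => ?_)
    (mem_span_of_straightening hstraighten s)
  exact ⟨(Prod.Lex.monotone_fst _ _ ht.2).trans_lt hs, ht.1⟩

end

end Quadratic

section Witt

attribute [local instance] LieRing.ofAssociativeRing

/-- A family in an associative algebra which satisfies the relations of the positive Witt algebra,
with `x i` in the role of the basis vector `e (i + 1)`. -/
def IsWittFamily (k : Type*) {A : Type*} [CommRing k] [Ring A] [Algebra k A] (x : ℕ → A) : Prop :=
  ∀ i j, ⁅x i, x j⁆ = ((j : k) - i) • x (i + j + 1)

namespace IsWittFamily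

section CommRing

variable {k A B : Type*} [CommRing k] [Ring A] [Ring B] [Algebra k A] [Algebra k B] {x : ℕ → A}
  {C : ℕ}

theorem map (hx : IsWittFamily k x) (π : A →ₐ[k] B) : IsWittFamily k (π ∘ x) := fun i j => by
  simp only [Function.comp_apply, ← map_smul, ← hx i j, Ring.lie_def, map_sub, map_mul]

theorem commutator_mem_weightLT (hx : IsWittFamily k x) {w : ℕ → ℕ} {i j d : ℕ}
    (h : w (i + j + 1) < d) : ⁅x i, x j⁆ ∈ weightLT k x w d := by
  rw [hx]
  exact Submodule.smul_mem _ _ (self_mem_weightLT h)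

theorem commutator_mem_quadraticSpan (hx : IsWittFamily k x) (hC : 2 ≤ C) {S : Set ℕ} {i j n : ℕ}
    (hij : i + j = n) : ⁅x i, x j⁆ ∈ quadraticSpan k x C S n :=
  weightLT_le_quadraticSpan (hx.commutator_mem_weightLT (by omega))

theorem mul_mem_quadraticSpan_of_right (hx : IsWittFamily k x) (hC : 2 ≤ C) {S : Set ℕ}
    {i j n : ℕ} (hj : j ∈ S) (hij : i + j = n) : x i * x j ∈ quadraticSpan k x C S n := by
  have hji : x j * x i ∈ quadraticSpan k x C S n := mul_mem_quadraticSpan hj (by omega)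
  exact (Submodule.sub_mem_iff_left _ hji).1 (hx.commutator_mem_quadraticSpan hC hij)

theorem lie_lie_mul (hx : IsWittFamily k x) (m n i j : ℕ) :
    ⁅x m, ⁅x n, x i * x j⁆⁆ =
      (((i : k) - n) * ((n + i + 1 : ℕ) - m)) • (x (m + (n + i + 1) + 1) * x j) +
      (((i : k) - n) * (j - m)) • (x (n + i + 1) * x (m + j + 1)) +
      (((j : k) - n) * (i - m)) • (x (m + i + 1) * x (n + j + 1)) +
      (((j : k) - n) * ((n + j + 1 : ℕ) - m)) • (x i * x (m + (n + j + 1) + 1)) := by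
  have hinner : ⁅x n, x i * x j⁆ =
      ((i : k) - n) • (x (n + i + 1) * x j) + ((j : k) - n) • (x i * x (n + j + 1)) := by
    rw [commutator_mul, hx, hx, smul_mul_assoc, mul_smul_comm]
  rw [hinner, lie_add, LieAlgebra.lie_smul, LieAlgebra.lie_smul, commutator_mul,
    commutator_mul, hx, hx, hx, hx]
  simp only [smul_mul_assoc, mul_smul_comm, smul_add, smul_smul, add_assoc]

theorem lie_lie_mul_sub_mem_quadraticSpan (hx : IsWittFamily k x) (hC : 2 ≤ C) {S : Set ℕ}
    {m n i j d : ℕ} (hi : i ∈ S) (hj : j ∈ S) (hd : n + j + 1 + (m + i + 1) = d) :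
    ⁅x m, ⁅x n, x i * x j⁆⁆ - ((((i : k) - n) * (j - m)) • (x (n + i + 1) * x (m + j + 1)) +
      (((j : k) - n) * (i - m)) • (x (n + j + 1) * x (m + i + 1))) ∈ quadraticSpan k x C S d := by
  have hleft : x (m + (n + i + 1) + 1) * x j ∈ quadraticSpan k x C S d :=
    hx.mul_mem_quadraticSpan_of_right hC hj (by omega)
  have hright : x i * x (m + (n + j + 1) + 1) ∈ quadraticSpan k x C S d :=
    mul_mem_quadraticSpan hi (by omega)
  have hflip : ⁅x (m + i + 1), x (n + j + 1)⁆ ∈ quadraticSpan k x C S d :=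
    hx.commutator_mem_quadraticSpan hC (by omega)
  convert add_mem (add_mem
    (Submodule.smul_mem _ (((i : k) - n) * ((n + i + 1 : ℕ) - m)) hleft)
    (Submodule.smul_mem _ (((j : k) - n) * (i - m)) hflip))
    (Submodule.smul_mem _ (((j : k) - n) * ((n + j + 1 : ℕ) - m)) hright) using 1
  rw [hx.lie_lie_mul, Ring.lie_def, smul_sub]
  abel

theorem lie_lie_mem_quadraticSpan (hx : IsWittFamily k x) (hC : 2 ≤ C) {m n i₀ j₀ : ℕ} {a : A}
    (ha : a ∈ quadraticSpan k x C (Set.Ioo i₀ j₀) (i₀ + j₀)) :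
    ⁅x m, ⁅x n, a⁆⁆ ∈ quadraticSpan k x C (Set.Iio (n + j₀ + 1)) (n + j₀ + 1 + (m + i₀ + 1)) := by
  set P := quadraticSpan k x C (Set.Iio (n + j₀ + 1)) (n + j₀ + 1 + (m + i₀ + 1))
  suffices hmap : quadraticSpan k x C (Set.Ioo i₀ j₀) (i₀ + j₀) ≤
      P.comap (LieAlgebra.ad k A (x m) * LieAlgebra.ad k A (x n)) from hmap ha
  refine sup_le (Submodule.span_le.2 ?_) fun b hb => ?_
  · rintro _ ⟨i, ⟨hi₀, hj₀⟩, j, hij, rfl⟩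
    have hi : x (n + i + 1) * x (m + j + 1) ∈ P :=
      mul_mem_quadraticSpan (Set.mem_Iio.2 (by omega)) (by omega)
    have hj : x (n + j + 1) * x (m + i + 1) ∈ P :=
      mul_mem_quadraticSpan (Set.mem_Iio.2 (by omega)) (by omega)
    exact (P.sub_mem_iff_left (add_mem (P.smul_mem _ hi) (P.smul_mem _ hj))).1 <|
      hx.lie_lie_mul_sub_mem_quadraticSpan hC (Set.mem_Iio.2 (by omega))
        (Set.mem_Iio.2 (by omega)) (by omega)
  · have hlie (l : ℕ) {b : A} {d : ℕ} (hb : b ∈ weightLT k x (· + C) d) :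
        ⁅x l, b⁆ ∈ weightLT k x (· + C) (d + (l + 1)) :=
      lie_mem_weightLT (fun i => hx.commutator_mem_weightLT (by omega)) hb
    exact weightLT_le_quadraticSpan (weightLT_mono (by omega) (hlie m (hlie n hb)))

end CommRing

section Field

variable {k A : Type*} [Field k] [CharZero k] [Ring A] [Algebra k A] {x : ℕ → A} {C : ℕ}

theorem exists_lie_lie_mul_sub_smul_mem (hx : IsWittFamily k x) (hC : 2 ≤ C) {m n i j : ℕ}
    (hij : i ≤ j) (hm : m ≠ i) (hn : n ≠ j) :
    ∃ c : k, c ≠ 0 ∧ ⁅x m, ⁅x n, x i * x j⁆⁆ - c • (x (n + j + 1) * x (m + i + 1)) ∈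
      quadraticSpan k x C (Set.Iio (n + j + 1)) (n + j + 1 + (m + i + 1)) := by
  have hc : ((j : k) - n) * (i - m) ≠ 0 := mul_ne_zero
    (sub_ne_zero.2 (Nat.cast_injective.ne hn.symm)) (sub_ne_zero.2 (Nat.cast_injective.ne hm.symm))
  have hmem := hx.lie_lie_mul_sub_mem_quadraticSpan hC (S := Set.Iio (n + j + 1)) (m := m) (n := n)
    (i := i) (j := j) (Set.mem_Iio.2 (by omega)) (Set.mem_Iio.2 (by omega)) rfl
  -- For `i = j` both terms of the congruence are the leading product, which doubles `c`.
  rcases hij.eq_or_lt with rfl | hlt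
  · refine ⟨_, mul_ne_zero two_ne_zero hc, ?_⟩
    rwa [← two_smul k, smul_smul] at hmem
  · refine ⟨_, hc, ?_⟩
    have hi : x (n + i + 1) * x (m + j + 1) ∈
        quadraticSpan k x C (Set.Iio (n + j + 1)) (n + j + 1 + (m + i + 1)) :=
      mul_mem_quadraticSpan (Set.mem_Iio.2 (by omega)) (by omega)
    rw [sub_add_eq_sub_sub_swap] at hmem
    exact (Submodule.sub_mem_iff_left _ (Submodule.smul_mem _ _ hi)).1 hmem

theorem mul_mem_quadraticSpan_of_lead (hx : IsWittFamily k x) (hC : 2 ≤ C) {i₀ j₀ p q : ℕ}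
    (hij : i₀ ≤ j₀) (hlead : x i₀ * x j₀ ∈ quadraticSpan k x C (Set.Ioo i₀ j₀) (i₀ + j₀))
    (hp : 2 * j₀ + 2 ≤ p) (hpq : p ≤ q) : x p * x q ∈ quadraticSpan k x C (Set.Iio p) (p + q) := by
  obtain ⟨n, rfl⟩ : ∃ n, p = n + j₀ + 1 := ⟨p - j₀ - 1, by omega⟩
  obtain ⟨m, rfl⟩ : ∃ m, q = m + i₀ + 1 := ⟨q - i₀ - 1, by omega⟩
  obtain ⟨c, hc, hmem⟩ :=
    hx.exists_lie_lie_mul_sub_smul_mem hC hij (m := m) (n := n) (by omega) (by omega)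
  rw [Submodule.sub_mem_iff_right _ (hx.lie_lie_mem_quadraticSpan hC hlead)] at hmem
  exact (Submodule.smul_mem_iff _ hc).1 hmem

end Field

end IsWittFamily

end Witt

section QuadraticRelation

theorem exists_le_eq_pair_of_card_eq_two {α : Type*} [LinearOrder α] {s : Multiset α}
    (hs : s.card = 2) : ∃ i j, i ≤ j ∧ s = {i, j} := by
  obtain ⟨i, j, rfl⟩ := Multiset.card_eq_two.1 hs
  rcases le_total i j with h | h
  · exact ⟨i, j, h, rfl⟩
  · exact ⟨j, i, h, Multiset.pair_comm i j⟩

theorem orderedMonomial_replicate_zero_add {A : Type*} [Monoid A] (x : ℕ → A) (m : ℕ)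
    (s : Multiset ℕ) :
    orderedMonomial x (Multiset.replicate m 0 + s) = x 0 ^ m * orderedMonomial x s := by
  induction m with
  | zero => simp
  | succ m ih =>
    rw [Multiset.replicate_succ, Multiset.cons_add,
      orderedMonomial_cons fun j _ => Nat.zero_le j, ih, pow_succ', mul_assoc]

section CommRing

variable {k A : Type*} [CommRing k] [Ring A] [Algebra k A] {x : ℕ → A}

theorem exists_relation_card_eq_two {a : Multiset ℕ →₀ k} (ha : a ≠ 0)
    (hcard : ∀ s ∈ a.support, s.card ≤ 2)
    (hrel : Finsupp.linearCombination k (orderedMonomial x) a = 0) :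
    ∃ b : Multiset ℕ →₀ k, (∀ s ∈ b.support, s.card ≤ 2) ∧ (∃ s ∈ b.support, s.card = 2) ∧
      Finsupp.linearCombination k (orderedMonomial x) b = 0 := by
  obtain ⟨t, ht, hmax⟩ :=
    a.support.exists_max_image Multiset.card (Finsupp.support_nonempty_iff.2 ha)
  have ht2 := hcard t ht
  -- Multiplying the relation by a power of `x 0` on the left raises its degree to `2`.
  refine ⟨a.embDomain (addLeftEmbedding (Multiset.replicate (2 - t.card) 0)), ?_, ?_, ?_⟩
  · simp only [Finsupp.support_embDomain, Finset.forall_mem_map, addLeftEmbedding_apply,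
      Multiset.card_add, Multiset.card_replicate]
    intro s hs
    have := hmax s hs
    omega
  · rw [Finsupp.support_embDomain]
    refine ⟨_, Finset.mem_map_of_mem _ ht, ?_⟩
    simp only [addLeftEmbedding_apply, Multiset.card_add, Multiset.card_replicate]
    omega
  · have hmul : orderedMonomial x ∘ addLeftEmbedding (Multiset.replicate (2 - t.card) 0) =
        LinearMap.mulLeft k (x 0 ^ (2 - t.card)) ∘ orderedMonomial x :=
      funext fun s => orderedMonomial_replicate_zero_add x _ s
    rw [Finsupp.linearCombination_embDomain, hmul, ← LinearMap.map_finsupp_linearCombination, hrel,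
      map_zero]

theorem orderedMonomial_mem_quadraticSpan {C i₀ j₀ : ℕ} {s : Multiset ℕ} (hC : 0 < C)
    (hcard : s.card ≤ 2) (hsC : ∀ i ∈ s, i < C) (hne : s ≠ {i₀, j₀})
    (hle : s.card = 2 → toLex (s.sum, s.sup) ≤ toLex (i₀ + j₀, j₀)) :
    orderedMonomial x s ∈ quadraticSpan k x C (Set.Ioo i₀ j₀) (i₀ + j₀) := by
  rcases hcard.lt_or_eq with h1 | h2
  · refine weightLT_le_quadraticSpan (orderedMonomial_mem_weightLT ?_)
    have hs : s.card = 0 ∨ s.card = 1 := by omega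
    rw [Multiset.card_eq_zero, Multiset.card_eq_one] at hs
    rcases hs with rfl | ⟨i, rfl⟩
    · rw [Multiset.map_zero, Multiset.sum_zero]
      omega
    · have := hsC i (Multiset.mem_singleton_self i)
      simp only [Multiset.map_singleton, Multiset.sum_singleton]
      omega
  · obtain ⟨i, j, hij, rfl⟩ := exists_le_eq_pair_of_card_eq_two h2
    have hle : toLex (i + j, j) ≤ toLex (i₀ + j₀, j₀) := by simpa [hij] using hle h2
    rcases Prod.Lex.toLex_le_toLex.1 hle with hlt | ⟨heq, hj⟩
    · refine weightLT_le_quadraticSpan (orderedMonomial_mem_weightLT ?_)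
      simp only [Multiset.insert_eq_cons, Multiset.map_cons, Multiset.map_singleton,
        Multiset.sum_cons, Multiset.sum_singleton]
      omega
    · have hj : j ≠ j₀ := by
        rintro rfl
        exact hne (by rw [Nat.add_right_cancel heq])
      rw [orderedMonomial_pair hij]
      exact mul_mem_quadraticSpan ⟨by omega, by omega⟩ heq

end CommRing

section Field

variable {k A : Type*} [Field k] [Ring A] [Algebra k A] {x : ℕ → A}

theorem exists_lead_mem_quadraticSpan {a : Multiset ℕ →₀ k} (hcard : ∀ s ∈ a.support, s.card ≤ 2)
    (htwo : ∃ s ∈ a.support, s.card = 2)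
    (hrel : Finsupp.linearCombination k (orderedMonomial x) a = 0) :
    ∃ C i₀ j₀, 2 ≤ C ∧ i₀ ≤ j₀ ∧
      x i₀ * x j₀ ∈ quadraticSpan k x C (Set.Ioo i₀ j₀) (i₀ + j₀) := by
  obtain ⟨t, ht, hmax⟩ := (a.support.filter (·.card = 2)).exists_max_image
    (fun s => toLex (s.sum, s.sup)) (by simpa [Finset.filter_nonempty_iff] using htwo)
  rw [Finset.mem_filter] at ht
  obtain ⟨i₀, j₀, hij, rfl⟩ := exists_le_eq_pair_of_card_eq_two ht.2
  refine ⟨2 + a.support.sup Multiset.sup, i₀, j₀, by omega, hij, ?_⟩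
  rw [← orderedMonomial_pair hij]
  refine mem_of_linearCombination_eq_zero hrel ht.1 fun s hs hne =>
    orderedMonomial_mem_quadraticSpan (by omega) (hcard s hs) (fun i hi => ?_) hne fun h2 => ?_
  · have hi' : i ≤ a.support.sup Multiset.sup :=
      (Multiset.le_sup hi).trans (Finset.le_sup (f := Multiset.sup) hs)
    omega
  · simpa [hij] using hmax s (Finset.mem_filter.2 ⟨hs, h2⟩)

theorem IsWittFamily.gkDim_lt_top [CharZero k] (hx : IsWittFamily k x)
    (hgen : Algebra.adjoin k (Set.range x) = ⊤) {a : Multiset ℕ →₀ k} (ha : a ≠ 0)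
    (hcard : ∀ s ∈ a.support, s.card ≤ 2)
    (hrel : Finsupp.linearCombination k (orderedMonomial x) a = 0) : gkDim k A < ⊤ := by
  obtain ⟨b, hb, htwo, hrelb⟩ := exists_relation_card_eq_two ha hcard hrel
  obtain ⟨C, i₀, j₀, hC, hij, hlead⟩ := exists_lead_mem_quadraticSpan hb htwo hrelb
  have hstd (d : ℕ) := weightLT_le_span_standard (C := C)
    (fun i j => hx.commutator_mem_weightLT (by omega))
    (fun p q hp hpq => hx.mul_mem_quadraticSpan_of_lead hC hij hlead hp hpq) d
  exact (gkDim_le_of_weightLT_le_span_standard hgen (by omega) hstd).trans_lt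
    (EReal.coe_lt_top _)

end Field

end QuadraticRelation

theorem universalEnvelopingAlgebra_adjoin_range_ι (k L : Type*) [CommRing k] [LieRing L]
    [LieAlgebra k L] :
    Algebra.adjoin k (Set.range (UniversalEnvelopingAlgebra.ι k : L → _)) = ⊤ := by
  have h : Set.range (UniversalEnvelopingAlgebra.ι k : L → _) =
      UniversalEnvelopingAlgebra.mkAlgHom k L '' Set.range (TensorAlgebra.ι k) := by
    rw [← Set.range_comp]
    rfl
  rw [h, ← AlgHom.map_adjoin, TensorAlgebra.adjoin_range_ι, Algebra.map_top,
    AlgHom.range_eq_top]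
  exact RingCon.mkₐ_surjective _

namespace PositiveWitt

section CommRing

variable (k : Type*) [CommRing k]

/-- The generators of `U(W₊)`, indexed by `ℕ`: `gen n` is the image of `e (n + 1)`. -/
noncomputable def gen (n : ℕ) : UniversalEnvelopingAlgebra k (PositiveWitt k) :=
  UniversalEnvelopingAlgebra.ι k (e k n.succPNat)

attribute [local instance] LieRing.ofAssociativeRing

theorem isWittFamily_gen : IsWittFamily k (gen k) := fun i j => by
  have h : i.succPNat + j.succPNat = (i + j + 1).succPNat := by
    apply PNat.eq
    simp only [PNat.add_coe, Nat.succPNat_coe]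
    omega
  rw [gen, gen, ← LieHom.map_lie, lie_e, h, map_smul, gen]
  simp

theorem range_ι_eq_span_gen :
    LinearMap.range (UniversalEnvelopingAlgebra.ι k :
      PositiveWitt k →ₗ⁅k⁆ UniversalEnvelopingAlgebra k (PositiveWitt k)).toLinearMap =
      Submodule.span k (Set.range (gen k)) := by
  have h : Set.range (gen k) = (UniversalEnvelopingAlgebra.ι k :
      PositiveWitt k →ₗ⁅k⁆ UniversalEnvelopingAlgebra k (PositiveWitt k)).toLinearMap ''
        Set.range (e k) := by
    rw [← Set.range_comp]
    exact Equiv.pnatEquivNat.symm.surjective.range_comp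
      ((UniversalEnvelopingAlgebra.ι k : PositiveWitt k →ₗ⁅k⁆ _).toLinearMap ∘ e k)
  rw [h, ← Submodule.map_span, (e k).span_eq, Submodule.map_top]

theorem adjoin_range_gen : Algebra.adjoin k (Set.range (gen k)) = ⊤ := by
  rw [← Algebra.adjoin_span, ← range_ι_eq_span_gen, LinearMap.coe_range]
  exact universalEnvelopingAlgebra_adjoin_range_ι k (PositiveWitt k)

theorem exists_linearCombination_eq_of_mem_orderFiltration {n : ℕ}
    {f : UniversalEnvelopingAlgebra k (PositiveWitt k)}
    (hf : f ∈ UniversalEnvelopingAlgebra.orderFiltration k (PositiveWitt k) n) :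
    ∃ a : Multiset ℕ →₀ k, (∀ s ∈ a.support, s.card ≤ n) ∧
      Finsupp.linearCombination k (orderedMonomial (gen k)) a = f := by
  have hgen : Submodule.span k (Set.range (gen k)) ≤ weightLT k (gen k) (fun _ => 1) (1 + 1) :=
    Submodule.span_le.2 <| Set.range_subset_iff.2 fun _ => self_mem_weightLT one_lt_two
  rw [UniversalEnvelopingAlgebra.orderFiltration, range_ι_eq_span_gen] at hf
  have hf := iSup_pow_le_weightLT hgen n hf
  rw [weightLT_eq_span_orderedMonomial
    fun i j => (isWittFamily_gen k).commutator_mem_weightLT one_lt_two] at hf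
  obtain ⟨a, ha, rfl⟩ := (Finsupp.mem_span_image_iff_linearCombination k).1 hf
  refine ⟨a, fun s hs => ?_, rfl⟩
  simpa [Nat.lt_succ_iff] using (Finsupp.mem_supported k a).1 ha hs

end CommRing

theorem adjoin_range_comp_gen {k A : Type*} [CommRing k] [Ring A] [Algebra k A]
    {π : UniversalEnvelopingAlgebra k (PositiveWitt k) →ₐ[k] A} (hπ : Function.Surjective π) :
    Algebra.adjoin k (Set.range (π ∘ gen k)) = ⊤ := by
  rw [Set.range_comp, ← AlgHom.map_adjoin, adjoin_range_gen, Algebra.map_top, AlgHom.range_eq_top]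
  exact hπ

end PositiveWitt

theorem corollary4p9 (k : Type*) [Field k] [CharZero k]
    (f : UniversalEnvelopingAlgebra k (PositiveWitt k)) (hf : f ≠ 0)
    (hord : f ∈ UniversalEnvelopingAlgebra.orderFiltration k (PositiveWitt k) 2) :
    gkDim k (TwoSidedIdeal.span {f}).ringCon.Quotient < ⊤ := by
  obtain ⟨a, hcard, hfa⟩ :=
    PositiveWitt.exists_linearCombination_eq_of_mem_orderFiltration k hord
  have ha : a ≠ 0 := by
    rintro rfl
    exact hf (by rw [← hfa, map_zero])
  set π := RingCon.mkₐ k (TwoSidedIdeal.span {f}).ringCon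
  have hπf : π f = 0 :=
    (RingCon.eq _).2 ((TwoSidedIdeal.mem_iff _ _).1 (TwoSidedIdeal.subset_span rfl))
  have hrel : Finsupp.linearCombination k (orderedMonomial (π ∘ PositiveWitt.gen k)) a = 0 := by
    rw [← map_linearCombination_orderedMonomial, hfa, hπf]
  exact ((PositiveWitt.isWittFamily_gen k).map π).gkDim_lt_top
    (PositiveWitt.adjoin_range_comp_gen (RingCon.mkₐ_surjective _)) ha hcard hrel
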